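/- Voters cast ballots, each a strict ranking of some or all of $n$ candidates, and a profile $P$ is a finite multiset of ballots. For $S$ seats, single transferable vote (STV) counts as follows. The quota is $\lfloor V/(S+1)\rfloor+1$, where $V$ is the number of voters. Each ballot is worth one vote and is first credited to its top candidate; every candidate whose vote total is at least the quota is elected, initially and again after every transfer. In each round, if some elected candidate's surplus (votes above the quota) has not been transferred yet, then the one with the largest vote total among such candidates has each of their ballots passed, with its value multiplied by surplus/(vote total), to the next candidate on it who is neither elected nor eliminated; otherwise a candidate with the fewest votes is eliminated and each of their ballots passes, at its current value, to the next candidate on it who is neither elected nor eliminated (a ballot without such a candidate is exhausted). The count stops when $S$ candidates are elected, or when the candidates elected and those remaining (neither elected nor eliminated) together number at most $S$, in which case those remaining win as well. When the winner set does not depend on how ties are broken, it is denoted $W(P,S)$. **Proposition.** Let $S>1$ be an integer. There exist a profile $P$ and a collection $\mathcal B$ of identical ballots, all ballots being complete rankings of the candidates, such that, with $P'$ the profile obtained by adding the ballots of $\mathcal B$ to $P$, the winner sets $W(P,S)$ and $W(P',S)$ do not depend on how ties are broken, and 1. every candidate in $W(P,S)$ is ranked in the top $S$ slots on the ballots in $\mathcal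 B$; 2. $|W(P,S)\cap W(P',S)|=1$, and none of the top $S-1$ candidates on the ballots in $\mathcal B$ is in $W(P',S)$; 3. every candidate in the bottom $S-1$ positions on the ballots in $\mathcal B$ is in $W(P',S)$. Moreover, $P$ and $\mathcal B$ can be chosen with $4$ candidates, $1000$ voters in $P$ and $3$ ballots in $\mathcal B$ if $S=2$, and with $2S-1$ candidates, $(S+1)\cdot 10^S$ voters in $P$ and $2(S+1)$ ballots in $\mathcal B$ if $S>2$. -/

import Mathlib

namespace STV

/-- A ballot: a nonempty strict ranking, most preferred first, of some or all of the candidates. -/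
structure Ballot (C : Type) where
  ranking : List C
  nodup : ranking.Nodup
  nonempty : ranking ≠ []

namespace Ballot

/-- The ballot ranks every candidate. -/
def IsComplete {C : Type} (b : Ballot C) : Prop := ∀ c : C, c ∈ b.ranking

/-- The candidates in the top `k` slots of the ballot. -/
def top {C : Type} (b : Ballot C) (k : ℕ) : List C := b.ranking.take k

/-- The candidates in the bottom `k` slots of the ballot. -/
def bottom {C : Type} (b : Ballot C) (k : ℕ) : List C :=
  b.ranking.drop (b.ranking.length - k)

end Ballot

/-- A preference profile: one ballot for each voter, the voters being anonymous. -/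
abbrev Profile (C : Type) : Type := Multiset (Ballot C)

/-- The quota `⌊(number of voters) / (S + 1)⌋ + 1` for `S` seats. -/
def quota {C : Type} (P : Profile C) (S : ℕ) : ℕ := P.card / (S + 1) + 1

/-- The state of the count between two rounds. Identical ballots are always treated alike, so
the holder and the value are recorded for each kind of ballot. -/
structure State (C : Type) where
  /-- candidates who are neither elected nor eliminated -/
  hopeful : Finset C
  /-- candidates elected by reaching the quota -/
  elected : Finset C
  /-- elected candidates whose surplus has not been transferred yet -/
  pending : Finset C
  /-- the candidate to whom such a ballot is currently credited (`none`: exhausted) -/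
  holder : Ballot C → Option C
  /-- the (fractional) vote that each such ballot is currently worth -/
  value : Ballot C → ℚ

namespace State

variable {C : Type} [DecidableEq C]

/-- The current (first-place) vote total of the candidate `c`. -/
def votes (P : Profile C) (s : State C) (c : C) : ℚ :=
  ((P.filter fun b => s.holder b = some c).map s.value).sum

/-- Declare elected all hopeful candidates whose vote total has reached the quota. -/
def declare (P : Profile C) (S : ℕ) (s : State C) : State C :=
  let new := s.hopeful.filter fun c => (quota P S : ℚ) ≤ s.votes P c
  { s with
    hopeful := s.hopeful \ new
    elected := s.elected ∪ new
    pending := s.pending ∪ new }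

/-- Eliminate `c`: each ballot held by `c` passes, at its current value, to the next candidate on
it who is neither elected nor eliminated. -/
def eliminate (s : State C) (c : C) : State C :=
  { s with
    hopeful := s.hopeful.erase c
    holder := fun b =>
      if s.holder b = some c then b.ranking.find? fun d => decide (d ∈ s.hopeful.erase c)
      else s.holder b }

/-- Transfer the surplus of the elected candidate `c`: each ballot held by `c` passes to the next
candidate on it who is neither elected nor eliminated, its value multiplied by
`(votes of c - quota) / (votes of c)`. -/
def transferSurplus (P : Profile C) (S : ℕ) (s : State C) (c : C) : State C :=
  { s with
    pending := s.pending.erase c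
    holder := fun b =>
      if s.holder b = some c then b.ranking.find? fun d => decide (d ∈ s.hopeful)
      else s.holder b
    value := fun b =>
      if s.holder b = some c then s.value b * ((s.votes P c - quota P S) / s.votes P c)
      else s.value b }

/-- The state before anybody is elected: each ballot is worth one vote and is credited to the
candidate ranked first on it. -/
def initial (C : Type) [Fintype C] : State C where
  hopeful := Finset.univ
  elected := ∅
  pending := ∅
  holder := fun b => b.ranking.head?
  value := fun _ => 1

/-- There is a seat to fill, and more candidates are left than can be seated. -/
def Running (S : ℕ) (s : State C) : Prop :=
  s.elected.card < S ∧ S < s.elected.card + s.hopeful.card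

/-- `s.Elects P S W`: from the state `s`, the count can end with the winner set `W`. While the
count is running, the largest untransferred surplus is transferred if there is one, and otherwise
a candidate with the fewest votes is eliminated; ties may be broken in any way. -/
inductive Elects (P : Profile C) (S : ℕ) : State C → Finset C → Prop
  | full (s : State C) (h : s.elected.card = S) : Elects P S s s.elected
  | fill (s : State C) (h : s.elected.card + s.hopeful.card ≤ S) :
      Elects P S s (s.elected ∪ s.hopeful)
  | surplus (s : State C) (c : C) (W : Finset C) (hs : s.Running S)
      (hc : c ∈ s.pending) (hmax : ∀ d ∈ s.pending, s.votes P d ≤ s.votes P c)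
      (h : Elects P S ((s.transferSurplus P S c).declare P S) W) : Elects P S s W
  | elimination (s : State C) (c : C) (W : Finset C) (hs : s.Running S)
      (hp : s.pending = ∅) (hc : c ∈ s.hopeful)
      (hmin : ∀ d ∈ s.hopeful, s.votes P c ≤ s.votes P d)
      (h : Elects P S ((s.eliminate c).declare P S) W) : Elects P S s W

end State

/-- `W` is a possible winner set of the election `(P, S)`, for some way to break ties. -/
def IsWinnerSet {C : Type} [Fintype C] [DecidableEq C] (P : Profile C) (S : ℕ)
    (W : Finset C) : Prop :=
  ((State.initial C).declare P S).Elects P S W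

/-- `W(P, S) = W`: whichever way ties are broken, the winner set of `(P, S)` is `W`. -/
def WinnersEq {C : Type} [Fintype C] [DecidableEq C] (P : Profile C) (S : ℕ)
    (W : Finset C) : Prop :=
  ∀ X : Finset C, IsWinnerSet P S X ↔ X = W

end STV

/-! Adding the ballots raises the quota just enough to shrink the surplus of the one candidate
elected at the start, and that surplus decides who is eliminated first. Every later elimination then
follows from the first.

For `S = 2` an explicit profile works. Candidate `1` has 336 votes. With quota 334 its surplus saves
`2`, so `3` is eliminated and its ballots elect `0`. With quota 335 the surplus is too small, so `2`
is eliminated and its ballots elect `3`.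

For `S = q + 3` the candidates are `m` and two lists `a`, `z` of length `q + 2`. Put `2 * h = 10 ^
S`. Then `m` has `2 * h + 3` votes and the quota is `2 * h + 1`, so a surplus of 2 goes to `a 0`.
This lifts `a 0` from `y - 1` to `y + 1`, above `z 0` with `y`, and `z 0` is eliminated. Its ballots
give each other `a j` a small lead, so `z 1`, `z 2`, ... are eliminated in turn, their ballots
passing to the `a` list. Adding `2 * (S + 1)` ballots raises the quota by 2, to exactly the total of
`m`. Nothing is left for `a 0`, and the mirror-image cascade eliminates the whole `a` list. The
numbers keep everyone but `m` below the quota until the survivors fill the seats.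

After the first transfer a state is determined by its set of hopefuls (`Settled`). `settled_start`
reaches such a state, `Layout.winnersEq` runs the cascade, and `winnersEq_largeProfile` and
`winnersEq_largeProfile_add` supply the numbers. -/

namespace STV

/-! ### Vote totals as a function of the set of hopefuls. -/

/-- The first member of `H` on the ballot. -/
def Ballot.next {C : Type} [DecidableEq C] (b : Ballot C) (H : Finset C) : Option C :=
  b.ranking.find? fun d => decide (d ∈ H)

/-- The vote total of `c` when each ballot `b`, worth `w b`, is credited to the first member of `H`
on it. -/
def tally {C : Type} [DecidableEq C] (P : Profile C) (w : Ballot C → ℚ) (H : Finset C) (c : C) : ℚ :=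
  ((P.filter fun b => b.next H = some c).map w).sum

section tally

variable {C : Type} [DecidableEq C]

/-- This makes the holder of a ballot independent of the order of eliminations: only ballots held by
the eliminated candidate move. -/
theorem Ballot.next_erase (b : Ballot C) (H : Finset C) (c : C) (h : b.next H ≠ some c) :
    b.next (H.erase c) = b.next H := by
  unfold Ballot.next at *
  generalize b.ranking = l at *
  induction l with
  | nil => rfl
  | cons x l ih =>
    by_cases hx : x ∈ H
    · have hxc : x ≠ c := by
        rintro rfl
        rw [List.find?_cons_of_pos (by simpa using hx)] at h
        exact h rfl
      rw [List.find?_cons_of_pos (by simp [hx, hxc]), List.find?_cons_of_pos (by simpa using hx)]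
    · have hx' : x ∉ H.erase c := fun h' => hx (Finset.mem_of_mem_erase h')
      rw [List.find?_cons_of_neg (by simpa only [decide_eq_true_eq] using hx)] at h
      rw [List.find?_cons_of_neg (by simpa only [decide_eq_true_eq] using hx'),
        List.find?_cons_of_neg (by simpa only [decide_eq_true_eq] using hx)]
      exact ih h

theorem Ballot.next_of_head (b : Ballot C) (H : Finset C) (c : C) (hb : b.ranking.head? = some c)
    (hc : c ∈ H) : b.next H = some c := by
  unfold Ballot.next
  obtain ⟨l, hl⟩ : ∃ l, b.ranking = c :: l := by
    cases h : b.ranking with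
    | nil => simp [h] at hb
    | cons x l => simp [h] at hb; exact ⟨l, by rw [hb]⟩
  simp [hl, hc]

theorem tally_add (P Q : Profile C) (w : Ballot C → ℚ) (H : Finset C) (c : C) :
    tally (P + Q) w H c = tally P w H c + tally Q w H c := by
  simp [tally]

theorem tally_sum {ι : Type} (s : Finset ι) (P : ι → Profile C) (w : Ballot C → ℚ) (H : Finset C)
    (c : C) : tally (∑ i ∈ s, P i) w H c = ∑ i ∈ s, tally (P i) w H c := by
  classical
  induction s using Finset.induction_on with
  | empty => simp [tally]
  | insert i s hi ih => rw [Finset.sum_insert hi, Finset.sum_insert hi, tally_add, ih]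

theorem tally_replicate (k : ℕ) (b : Ballot C) (w : Ballot C → ℚ) (H : Finset C) (c : C) :
    tally (Multiset.replicate k b) w H c = if b.next H = some c then k * w b else 0 := by
  split_ifs with h
  · rw [tally, Multiset.filter_eq_self.2]
    · simp
    · intro a ha
      rwa [Multiset.eq_of_mem_replicate ha]
  · rw [tally, Multiset.filter_eq_nil.2]
    · simp
    · intro a ha
      rwa [Multiset.eq_of_mem_replicate ha]

end tally

/-! ### Reduction of the count to forced steps. -/

/-- The worth of a ballot once the surplus of the first elected candidate `m` has been transferred
with factor `ρ`. -/
def weight {C : Type} [DecidableEq C] (m : C) (ρ : ℚ) (b : Ballot C) : ℚ :=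
  if b.ranking.head? = some m then ρ else 1

namespace State

variable {C : Type} [DecidableEq C]

/-- No surplus is pending, and each ballot of `P` is credited to its first hopeful candidate. -/
structure Settled (P : Profile C) (w : Ballot C → ℚ) (H E : Finset C) (s : State C) : Prop where
  hopeful : s.hopeful = H
  elected : s.elected = E
  pending : s.pending = ∅
  holder : ∀ b ∈ P, s.holder b = b.next H
  value : ∀ b ∈ P, s.value b = w b

variable {P : Profile C} {S : ℕ} {w : Ballot C → ℚ} {H E : Finset C} {s : State C}

theorem Settled.votes (h : s.Settled P w H E) (c : C) : s.votes P c = tally P w H c := by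
  unfold State.votes tally
  rw [Multiset.filter_congr fun b hb => by rw [h.holder b hb]]
  exact congrArg _ (Multiset.map_congr rfl fun b hb => h.value b (Multiset.mem_filter.1 hb).1)

theorem Settled.eliminate (h : s.Settled P w H E) (c : C) :
    (s.eliminate c).Settled P w (H.erase c) E where
  hopeful := by simp [State.eliminate, h.hopeful]
  elected := by simp [State.eliminate, h.elected]
  pending := by simp [State.eliminate, h.pending]
  holder := fun b hb => by
    simp only [State.eliminate, h.holder b hb, h.hopeful]
    split_ifs with hc
    · rfl
    · exact (b.next_erase H c hc).symm
  value := fun b hb => by simp [State.eliminate, h.value b hb]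

theorem declare_eq_self (h : ∀ c ∈ s.hopeful, s.votes P c < quota P S) : s.declare P S = s := by
  have : (s.hopeful.filter fun c => (quota P S : ℚ) ≤ s.votes P c) = ∅ :=
    Finset.filter_eq_empty_iff.2 fun c hc => not_le.2 (h c hc)
  simp [declare, this]

theorem elects_iff_of_full (h : s.elected.card = S) (X : Finset C) :
    s.Elects P S X ↔ X = s.elected := by
  constructor
  · intro hX
    cases hX with
    | full => rfl
    | fill _ h' =>
      have : s.hopeful = ∅ := Finset.card_eq_zero.1 (by omega)
      simp [this]
    | surplus _ _ _ hs => exact absurd hs.1 (by omega)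
    | elimination _ _ _ hs => exact absurd hs.1 (by omega)
  · rintro rfl
    exact .full s h

theorem elects_iff_of_fill (h : s.elected.card + s.hopeful.card = S) (X : Finset C) :
    s.Elects P S X ↔ X = s.elected ∪ s.hopeful := by
  constructor
  · intro hX
    cases hX with
    | full _ h' =>
      have : s.hopeful = ∅ := Finset.card_eq_zero.1 (by omega)
      simp [this]
    | fill _ h' => rfl
    | surplus _ _ _ hs => exact absurd hs.2 (by omega)
    | elimination _ _ _ hs => exact absurd hs.2 (by omega)
  · rintro rfl
    exact .fill s h.le

theorem elects_iff_surplus (hs : s.Running S) (c : C) (hc : s.pending = {c}) (X : Finset C) :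
    s.Elects P S X ↔ ((s.transferSurplus P S c).declare P S).Elects P S X := by
  constructor
  · intro hX
    cases hX with
    | full _ h' => exact absurd hs.1 (by omega)
    | fill _ h' => exact absurd hs.2 (by omega)
    | surplus _ d _ _ hd _ h =>
      rw [hc, Finset.mem_singleton] at hd
      exact hd ▸ h
    | elimination _ _ _ _ hp => simp [hc] at hp
  · exact .surplus s c X hs (by simp [hc]) (by simp [hc])

/-- Strictness of the minimum leaves no tie to break, so the round has a single continuation. -/
theorem elects_iff_elimination (hs : s.Running S) (hp : s.pending = ∅) (c : C) (hc : c ∈ s.hopeful)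
    (hmin : ∀ d ∈ s.hopeful, d ≠ c → s.votes P c < s.votes P d) (X : Finset C) :
    s.Elects P S X ↔ ((s.eliminate c).declare P S).Elects P S X := by
  constructor
  · intro hX
    cases hX with
    | full _ h' => exact absurd hs.1 (by omega)
    | fill _ h' => exact absurd hs.2 (by omega)
    | surplus _ d _ _ hd => simp [hp] at hd
    | elimination _ d _ _ _ hd hd' h =>
      obtain rfl : d = c := by
        by_contra hne
        exact absurd (hd' c hc) (not_le.2 (hmin d hd hne))
      exact h
  · refine .elimination s c X hs hp hc fun d hd => ?_
    rcases eq_or_ne d c with rfl | hne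
    · exact le_rfl
    · exact (hmin d hd hne).le

theorem Settled.elects_iff_eliminate (h : s.Settled P w H E) (hE : E.card < S)
    (hH : S < E.card + H.card) (hq : ∀ d ∈ H, tally P w H d < quota P S) (c : C) (hc : c ∈ H)
    (hmin : ∀ d ∈ H, d ≠ c → tally P w H c < tally P w H d) (X : Finset C) :
    (s.declare P S).Elects P S X ↔ ((s.eliminate c).declare P S).Elects P S X := by
  have hd : s.declare P S = s := declare_eq_self fun d hd => by
    rw [h.votes]
    exact hq d (h.hopeful ▸ hd)
  rw [hd]
  refine elects_iff_elimination ⟨?_, ?_⟩ h.pending c (h.hopeful ▸ hc) (fun d hd hne => ?_) X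
  · rwa [h.elected]
  · rwa [h.elected, h.hopeful]
  · rw [h.votes, h.votes]
    exact hmin d (h.hopeful ▸ hd) hne

/-- Reaching the quota at this point only moves candidates from the hopefuls to the elected, and the
union is unchanged. Hence no bound on the totals is needed. -/
theorem Settled.elects_iff_of_fill (h : s.Settled P w H E) (hd : Disjoint E H)
    (hS : E.card + H.card = S) (X : Finset C) :
    (s.declare P S).Elects P S X ↔ X = E ∪ H := by
  have hu : (s.declare P S).elected ∪ (s.declare P S).hopeful = E ∪ H := by
    simp only [declare, h.elected, h.hopeful]
    ext c
    simp only [Finset.mem_union, Finset.mem_sdiff, Finset.mem_filter]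
    tauto
  have hd' : Disjoint (s.declare P S).elected (s.declare P S).hopeful := by
    simp only [declare, h.elected, h.hopeful]
    rw [Finset.disjoint_left] at hd ⊢
    intro c
    have := @hd c
    simp only [Finset.mem_union, Finset.mem_sdiff, Finset.mem_filter]
    tauto
  rw [State.elects_iff_of_fill, hu]
  rw [← Finset.card_union_of_disjoint hd', hu, Finset.card_union_of_disjoint hd, hS]

theorem Settled.elects_iff_of_full (h : s.Settled P w H E) (N : Finset C)
    (hN : ∀ c, c ∈ N ↔ c ∈ H ∧ quota P S ≤ tally P w H c) (hS : (E ∪ N).card = S) (X : Finset C) :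
    (s.declare P S).Elects P S X ↔ X = E ∪ N := by
  have hu : (s.declare P S).elected = E ∪ N := by
    simp only [declare, h.elected, h.hopeful]
    ext c
    simp only [Finset.mem_union, Finset.mem_filter, hN, h.votes]
  rw [State.elects_iff_of_full (by rw [hu, hS]), hu]

theorem votes_initial [Fintype C] (P : Profile C) (c : C) :
    (initial C).votes P c = tally P (fun _ => 1) Finset.univ c := by
  unfold State.votes tally
  refine congrArg _ (congrArg _ (Multiset.filter_congr fun b _ => ?_))
  have : b.next Finset.univ = b.ranking.head? := by
    cases h : b.ranking <;> simp [Ballot.next, h]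
  rw [this]
  rfl

/-- Bounding the other totals after the transfer suffices: the transfer only adds ballots of
nonnegative worth to them, so they were below the quota before it as well, and `m` alone is elected
initially. -/
theorem settled_start [Fintype C] (m : C) (hS : 1 < S) (hC : S < Fintype.card C) (M : ℕ)
    (hM : (initial C).votes P m = M) (hQ : quota P S ≤ M)
    (hq : ∀ c, c ≠ m →
      tally P (weight m ((M - quota P S) / M)) (Finset.univ.erase m) c < quota P S) :
    ∃ s : State C,
      s.Settled P (weight m ((M - quota P S) / M)) (Finset.univ.erase m) {m} ∧
      ∀ X, IsWinnerSet P S X ↔ (s.declare P S).Elects P S X := by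
  have hlow : ∀ c, c ≠ m → (initial C).votes P c < quota P S := fun c hc => by
    refine lt_of_le_of_lt ?_ (hq c hc)
    set w := weight m (((M : ℚ) - quota P S) / M) with hw
    have hw0 : ∀ b, 0 ≤ w b := fun b => by
      rw [hw, weight]
      split_ifs
      · exact div_nonneg (sub_nonneg.2 (by exact_mod_cast hQ)) (Nat.cast_nonneg _)
      · exact zero_le_one
    have h1 : (initial C).votes P c =
        ((P.filter fun b => b.ranking.head? = some c).map w).sum := by
      unfold State.votes initial
      refine congrArg _ (Multiset.map_congr rfl fun b hb => ?_)
      rw [hw, weight, if_neg]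
      rw [(Multiset.mem_filter.1 hb).2]
      simpa using hc
    rw [h1, tally]
    have h2 : (P.filter fun b => b.ranking.head? = some c) ≤
        P.filter fun b => b.next (Finset.univ.erase m) = some c :=
      Multiset.monotone_filter_right P fun b hb => b.next_of_head _ c hb (by simpa using hc)
    obtain ⟨R, hR⟩ := Multiset.le_iff_exists_add.1 h2
    rw [hR, Multiset.map_add, Multiset.sum_add]
    refine le_add_of_nonneg_right (Multiset.sum_nonneg fun x hx => ?_)
    obtain ⟨b, -, rfl⟩ := Multiset.mem_map.1 hx
    exact hw0 b
  have hnew : ((initial C).hopeful.filter fun c => (quota P S : ℚ) ≤ (initial C).votes P c) =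
      {m} := by
    ext c
    rw [Finset.mem_filter, Finset.mem_singleton]
    constructor
    · rintro ⟨-, h⟩
      by_contra hc
      exact absurd h (not_le.2 (hlow c hc))
    · rintro rfl
      exact ⟨by simp [initial], by rw [hM]; exact_mod_cast hQ⟩
  have hdecl : (initial C).declare P S =
      { (initial C) with hopeful := Finset.univ.erase m, elected := {m}, pending := {m} } := by
    simp only [declare, hnew]
    simp [initial, Finset.sdiff_singleton_eq_erase]
  refine ⟨((initial C).declare P S).transferSurplus P S m, ⟨?_, ?_, ?_, ?_, ?_⟩, fun X => ?_⟩
  · simp [hdecl, transferSurplus]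
  · simp [hdecl, transferSurplus]
  · simp [hdecl, transferSurplus]
  · intro b _
    rw [hdecl]
    simp only [transferSurplus, initial]
    split_ifs with hb
    · rfl
    · cases hr : b.ranking.head? with
      | none => simp [List.head?_eq_none_iff, b.nonempty] at hr
      | some c =>
        refine (b.next_of_head _ c hr ?_).symm
        rw [hr] at hb
        simpa using hb
  · intro b _
    have hv : State.votes P ((initial C).declare P S) m = M := by
      rw [← hM]
      rfl
    simp only [transferSurplus, hv, weight]
    rw [hdecl]
    simp [initial]
  · refine elects_iff_surplus ⟨?_, ?_⟩ m (by simp [hdecl]) X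
    · simp [hdecl, hS]
    · simp only [hdecl, Finset.card_singleton, Finset.card_erase_of_mem (Finset.mem_univ m),
        Finset.card_univ]
      omega

end State
-- The example with two seats.
/-- The ballot on four candidates with the given ranking. -/
def ballotFour (l : List (Fin 4)) (h : l.Nodup ∧ l ≠ []) : Ballot (Fin 4) := ⟨l, h.1, h.2⟩

/-- A two-seat profile on the candidates `0, 1, 2, 3` with `r` ballots `0 > 1 > 2 > 3`. -/
def twoSeatProfile (r : ℕ) : Profile (Fin 4) :=
  Multiset.replicate 224 (ballotFour [1, 2, 3, 0] (by decide)) +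
  Multiset.replicate 112 (ballotFour [1, 0, 2, 3] (by decide)) +
  Multiset.replicate 180 (ballotFour [2, 3, 0, 1] (by decide)) +
  Multiset.replicate 181 (ballotFour [3, 0, 2, 1] (by decide)) +
  Multiset.replicate r (ballotFour [0, 1, 2, 3] (by decide))

theorem card_twoSeatProfile (r : ℕ) : (twoSeatProfile r).card = 697 + r := by
  simp only [twoSeatProfile, Multiset.card_add, Multiset.card_replicate]

theorem tally_twoSeatProfile (r : ℕ) (ρ : ℚ) (H : Finset (Fin 4)) (c : Fin 4) :
    tally (twoSeatProfile r) (weight 1 ρ) H c =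
      (if [1, 2, 3, 0].find? (fun d => decide (d ∈ H)) = some c then 224 * ρ else 0) +
      (if [1, 0, 2, 3].find? (fun d => decide (d ∈ H)) = some c then 112 * ρ else 0) +
      (if [2, 3, 0, 1].find? (fun d => decide (d ∈ H)) = some c then 180 else 0) +
      (if [3, 0, 2, 1].find? (fun d => decide (d ∈ H)) = some c then 181 else 0) +
      (if [0, 1, 2, 3].find? (fun d => decide (d ∈ H)) = some c then (r : ℚ) else 0) := by
  simp only [twoSeatProfile, tally_add, tally_replicate, ballotFour, Ballot.next, weight]
  simp

theorem votes_initial_twoSeatProfile (r : ℕ) :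
    (State.initial (Fin 4)).votes (twoSeatProfile r) 1 = (336 : ℕ) := by
  -- Factor 1 turns the weighted tally into the plain initial count.
  have h : (fun _ => 1 : Ballot (Fin 4) → ℚ) = weight 1 1 := by
    ext b
    simp [weight]
  rw [State.votes_initial, h, tally_twoSeatProfile]
  simp
  norm_num

theorem twoSeatProfile_winners : WinnersEq (twoSeatProfile 303) 2 {0, 1} := by
  have hQ : quota (twoSeatProfile 303) 2 = 334 := by simp [quota, card_twoSeatProfile]
  obtain ⟨s, hs, hX⟩ := State.settled_start (P := twoSeatProfile 303) (S := 2) 1 one_lt_two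
    (by simp) 336 (votes_initial_twoSeatProfile 303) (by rw [hQ]; norm_num) (fun c hc => by
      rw [hQ, tally_twoSeatProfile]
      fin_cases c <;> simp at hc ⊢ <;> norm_num)
  rw [hQ] at hs
  -- The factor is 2/336, so `2` has 180 + 4/3 votes against 181 for `3`.
  have he : ∀ X, (s.declare (twoSeatProfile 303) 2).Elects (twoSeatProfile 303) 2 X ↔ _ :=
    hs.elects_iff_eliminate (by simp) (by simp) (fun c hc => by
      rw [hQ, tally_twoSeatProfile]
      fin_cases c <;> simp at hc ⊢ <;> norm_num) 3 (by simp) (fun c hc hc' => by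
      rw [tally_twoSeatProfile, tally_twoSeatProfile]
      fin_cases c <;> simp at hc hc' ⊢ <;> norm_num)
  have hW : ({0, 1} : Finset (Fin 4)) = {1} ∪ {0} := by decide
  intro X
  rw [hX, he, hW, (hs.eliminate 3).elects_iff_of_full {0} _ (by simp)]
  intro c
  rw [hQ, tally_twoSeatProfile]
  fin_cases c <;> simp <;> norm_num

theorem twoSeatProfile_winners_of_added : WinnersEq (twoSeatProfile 306) 2 {1, 3} := by
  have hQ : quota (twoSeatProfile 306) 2 = 335 := by simp [quota, card_twoSeatProfile]
  obtain ⟨s, hs, hX⟩ := State.settled_start (P := twoSeatProfile 306) (S := 2) 1 one_lt_two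
    (by simp) 336 (votes_initial_twoSeatProfile 306) (by rw [hQ]; norm_num) (fun c hc => by
      rw [hQ, tally_twoSeatProfile]
      fin_cases c <;> simp at hc ⊢ <;> norm_num)
  rw [hQ] at hs
  -- The factor is now 1/336, so `2` has only 180 + 2/3 votes against 181 for `3`.
  have he : ∀ X, (s.declare (twoSeatProfile 306) 2).Elects (twoSeatProfile 306) 2 X ↔ _ :=
    hs.elects_iff_eliminate (by simp) (by simp) (fun c hc => by
      rw [hQ, tally_twoSeatProfile]
      fin_cases c <;> simp at hc ⊢ <;> norm_num) 2 (by simp) (fun c hc hc' => by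
      rw [tally_twoSeatProfile, tally_twoSeatProfile]
      fin_cases c <;> simp at hc hc' ⊢ <;> norm_num)
  have hW : ({1, 3} : Finset (Fin 4)) = {1} ∪ {3} := by decide
  intro X
  rw [hX, he, hW, (hs.eliminate 2).elects_iff_of_full {3} _ (by simp)]
  intro c
  rw [hQ, tally_twoSeatProfile]
  fin_cases c <;> simp <;> norm_num

theorem exists_two_seat_example :
    ∃ (P : Profile (Fin 4)) (b : Ballot (Fin 4)) (W W' : Finset (Fin 4)),
      P.card = 1000 ∧ (∀ a ∈ P, a.IsComplete) ∧ b.IsComplete ∧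
      WinnersEq P 2 W ∧ WinnersEq (P + Multiset.replicate 3 b) 2 W' ∧
      (∀ c ∈ W, c ∈ b.top 2) ∧ (W ∩ W').card = 1 ∧ (∀ c ∈ b.top 1, c ∉ W') ∧
      (∀ c ∈ b.bottom 1, c ∈ W') := by
  refine ⟨twoSeatProfile 303, ballotFour [0, 1, 2, 3] (by decide), {0, 1}, {1, 3},
    card_twoSeatProfile 303, ?_, ?_, twoSeatProfile_winners, ?_, ?_,
    by decide, ?_, ?_⟩
  · intro a ha
    simp only [twoSeatProfile, Multiset.mem_add] at ha
    rcases ha with (((ha | ha) | ha) | ha) | ha <;> rw [Multiset.eq_of_mem_replicate ha] <;>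
      unfold Ballot.IsComplete ballotFour <;> decide
  · unfold Ballot.IsComplete ballotFour
    decide
  · have h : twoSeatProfile 303 + Multiset.replicate 3 (ballotFour [0, 1, 2, 3] (by decide)) =
        twoSeatProfile 306 := by
      rw [twoSeatProfile, add_assoc, ← Multiset.replicate_add]
      rfl
    rw [h]
    exact twoSeatProfile_winners_of_added
  · unfold Ballot.top ballotFour
    decide
  · unfold Ballot.top ballotFour
    decide
  · unfold Ballot.bottom ballotFour
    decide

/-! ### Two competing lists of candidates, and the cascade that eliminates one of them. -/

/-- The complete ballot that ranks `x` first and, if `y ≠ x`, ranks `y` second. -/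
noncomputable def Ballot.ofPair {C : Type} [Fintype C] [DecidableEq C] (x y : C) : Ballot C where
  ranking := x :: (y :: Finset.univ.toList.erase y).erase x
  nodup := by
    have h : (y :: (Finset.univ : Finset C).toList.erase y).Nodup :=
      List.nodup_cons.2 ⟨(Finset.nodup_toList _).not_mem_erase, (Finset.nodup_toList _).erase y⟩
    exact List.nodup_cons.2 ⟨h.not_mem_erase, h.erase x⟩
  nonempty := by simp

section ofPair

variable {C : Type} [Fintype C] [DecidableEq C]

theorem Ballot.ofPair_isComplete (x y : C) : (Ballot.ofPair x y).IsComplete := by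
  intro c
  by_cases hx : c = x
  · simp [ofPair, hx]
  · refine List.mem_cons_of_mem _ ((List.mem_erase_of_ne hx).2 ?_)
    by_cases hy : c = y
    · simp [hy]
    · exact List.mem_cons_of_mem _ ((List.mem_erase_of_ne hy).2 (by simp))

theorem Ballot.ofPair_next (x y : C) (H : Finset C) (hxy : x ≠ y) (h : x ∈ H ∨ y ∈ H) :
    (Ballot.ofPair x y).next H = if x ∈ H then some x else some y := by
  split_ifs with hx
  · simp [ofPair, next, hx]
  · simp [ofPair, next, hx, h.resolve_left hx, hxy.symm]

theorem weight_ofPair (m x y : C) (ρ : ℚ) :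
    weight m ρ (Ballot.ofPair x y) = if x = m then ρ else 1 := by
  simp [weight, Ballot.ofPair]

end ofPair

/-- The candidates are `m` and the members of two lists `u` and `v` of length `n`. -/
structure Layout {C : Type} (n : ℕ) (m : C) (u v : ℕ → C) : Prop where
  u_inj : ∀ i < n, ∀ j < n, u i = u j → i = j
  v_inj : ∀ i < n, ∀ j < n, v i = v j → i = j
  u_ne_v : ∀ i < n, ∀ j < n, u i ≠ v j
  u_ne : ∀ i < n, u i ≠ m
  v_ne : ∀ i < n, v i ≠ m
  cover : ∀ c, c = m ∨ (∃ i < n, c = u i) ∨ ∃ i < n, c = v i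

theorem Layout.symm {C : Type} {n : ℕ} {m : C} {u v : ℕ → C} (h : Layout n m u v) : Layout n m v u :=
  ⟨h.v_inj, h.u_inj, fun i hi j hj => (h.u_ne_v j hj i hi).symm, h.v_ne, h.u_ne,
    fun c => (h.cover c).imp_right Or.symm⟩

/-- The candidates other than `m` and the first `k` members of `v`. -/
def remaining {C : Type} [Fintype C] [DecidableEq C] (m : C) (v : ℕ → C) : ℕ → Finset C
  | 0 => Finset.univ.erase m
  | k + 1 => (remaining m v k).erase (v k)

/-- A profile with, for all `i, j < n`, `D i j` ballots `v i > u j > ⋯` and `E i j` ballots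
`u i > v j > ⋯`. -/
noncomputable def pairProfile {C : Type} [Fintype C] [DecidableEq C] (n : ℕ) (u v : ℕ → C)
    (D E : ℕ → ℕ → ℕ) : Profile C :=
  ∑ i ∈ Finset.range n, ∑ j ∈ Finset.range n,
    (Multiset.replicate (D i j) (Ballot.ofPair (v i) (u j)) +
      Multiset.replicate (E i j) (Ballot.ofPair (u i) (v j)))

section Layout

variable {C : Type} [Fintype C] [DecidableEq C] {n : ℕ} {m : C} {u v : ℕ → C}

theorem mem_remaining (k : ℕ) (c : C) : c ∈ remaining m v k ↔ c ≠ m ∧ ∀ i < k, c ≠ v i := by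
  induction k with
  | zero => simp [remaining]
  | succ k ih =>
    rw [remaining, Finset.mem_erase, ih]
    constructor
    · rintro ⟨h1, h2, h3⟩
      refine ⟨h2, fun i hi => ?_⟩
      rcases Nat.lt_succ_iff_lt_or_eq.1 hi with h | rfl
      · exact h3 i h
      · exact h1
    · rintro ⟨h1, h2⟩
      exact ⟨h2 k k.lt_succ_self, h1, fun i hi => h2 i (hi.trans k.lt_succ_self)⟩

theorem Layout.u_mem_remaining (h : Layout n m u v) {k j : ℕ} (hk : k ≤ n) (hj : j < n) :
    u j ∈ remaining m v k :=
  (mem_remaining k _).2 ⟨h.u_ne j hj, fun i hi => h.u_ne_v j hj i (hi.trans_le hk)⟩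

theorem Layout.v_mem_remaining (h : Layout n m u v) {k j : ℕ} (hk : k ≤ n) (hj : j < n) :
    v j ∈ remaining m v k ↔ k ≤ j := by
  rw [mem_remaining]
  constructor
  · rintro ⟨-, h'⟩
    by_contra hkj
    exact h' j (not_le.1 hkj) rfl
  · intro hkj
    refine ⟨h.v_ne j hj, fun i hi hij => ?_⟩
    have := h.v_inj j hj i (hi.trans_le hk) hij
    omega

theorem Layout.remaining_eq (h : Layout n m u v) : remaining m v n = (Finset.range n).image u := by
  ext c
  rw [Finset.mem_image]
  constructor
  · intro hc
    rcases h.cover c with rfl | ⟨i, hi, rfl⟩ | ⟨i, hi, rfl⟩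
    · exact absurd rfl ((mem_remaining n _).1 hc).1
    · exact ⟨i, Finset.mem_range.2 hi, rfl⟩
    · exact absurd ((h.v_mem_remaining le_rfl hi).1 hc) (not_le.2 hi)
  · rintro ⟨i, hi, rfl⟩
    exact h.u_mem_remaining le_rfl (Finset.mem_range.1 hi)

theorem Layout.card_remaining (h : Layout n m u v) {k : ℕ} (hk : k ≤ n) :
    (remaining m v k).card = 2 * n - k := by
  induction hk using Nat.decreasingInduction with
  | self =>
    rw [h.remaining_eq, Finset.card_image_of_injOn, Finset.card_range]
    · omega
    · intro i hi j hj hij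
      exact h.u_inj i (by simpa using hi) j (by simpa using hj) hij
  | of_succ k hk ih =>
    have := Finset.card_erase_add_one ((h.v_mem_remaining hk.le hk).2 le_rfl)
    rw [remaining] at ih
    omega

/-- If no member of `remaining m v k` reaches the quota and `v k` has the fewest votes in it, for
each `k < n`, then `m` and the members of `u` win. -/
theorem Layout.winnersEq (h : Layout n m u v) (hn : 0 < n) {P : Profile C} (M : ℕ)
    (hM : (State.initial C).votes P m = M) (hQ : quota P (n + 1) ≤ M) {ρ : ℚ}
    (hρ : ρ = (M - quota P (n + 1)) / M)
    (hq : ∀ k < n, ∀ c ∈ remaining m v k,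
      tally P (weight m ρ) (remaining m v k) c < quota P (n + 1))
    (hmin : ∀ k < n, ∀ c ∈ remaining m v k, c ≠ v k →
      tally P (weight m ρ) (remaining m v k) (v k) < tally P (weight m ρ) (remaining m v k) c) :
    WinnersEq P (n + 1) ({m} ∪ (Finset.range n).image u) := by
  have hcard : Fintype.card C = 2 * n + 1 := by
    have := h.card_remaining n.zero_le
    rw [remaining] at this
    have := Finset.card_erase_add_one (Finset.mem_univ m)
    rw [Finset.card_univ] at this
    omega
  subst hρ
  obtain ⟨s, hs, hX⟩ := State.settled_start m (by omega : 1 < n + 1) (by omega) M hM hQ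
    fun c hc => hq 0 hn c (by simpa [remaining] using hc)
  -- Backward induction on the number `k` of eliminations already made: at `k = n` the survivors
  -- exactly fill the seats.
  have key : ∀ k ≤ n, ∀ s : State C,
      s.Settled P (weight m ((M - quota P (n + 1)) / M)) (remaining m v k) {m} →
      ∀ X, (s.declare P (n + 1)).Elects P (n + 1) X ↔ X = {m} ∪ (Finset.range n).image u := by
    intro k hk
    induction hk using Nat.decreasingInduction with
    | self =>
      intro s hs X
      rw [hs.elects_iff_of_fill, h.remaining_eq]
      · simp [mem_remaining]
      · rw [h.card_remaining le_rfl, Finset.card_singleton]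
        omega
    | of_succ k hk ih =>
      intro s hs X
      rw [hs.elects_iff_eliminate _ _ (hq k hk) (v k) ((h.v_mem_remaining hk.le hk).2 le_rfl)
        (hmin k hk)]
      · exact ih _ (hs.eliminate (v k)) X
      · rw [Finset.card_singleton]
        omega
      · rw [h.card_remaining hk.le, Finset.card_singleton]
        omega
  exact fun X => (hX X).trans (key 0 n.zero_le s hs X)

theorem pairProfile_comm (n : ℕ) (u v : ℕ → C) (D E : ℕ → ℕ → ℕ) :
    pairProfile n u v D E = pairProfile n v u E D := by
  simp only [pairProfile, add_comm]

theorem pairProfile_isComplete (D E : ℕ → ℕ → ℕ) : ∀ a ∈ pairProfile n u v D E, a.IsComplete := by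
  intro a ha
  simp only [pairProfile, Multiset.mem_sum, Multiset.mem_add] at ha
  obtain ⟨i, -, j, -, ha | ha⟩ := ha <;> rw [Multiset.eq_of_mem_replicate ha] <;>
    exact Ballot.ofPair_isComplete _ _

theorem card_pairProfile (D E : ℕ → ℕ → ℕ) : (pairProfile n u v D E).card =
    ∑ i ∈ Finset.range n, ((∑ j ∈ Finset.range n, D i j) + ∑ j ∈ Finset.range n, E i j) := by
  simp only [pairProfile, Multiset.card_sum, Multiset.card_add, Multiset.card_replicate,
    Finset.sum_add_distrib]

/-- No member of `u` has been eliminated, so a ballot never passes beyond its second slot, and the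
rest of its ranking is irrelevant. -/
theorem Layout.tally_pairProfile (h : Layout n m u v) (D E : ℕ → ℕ → ℕ) (ρ : ℚ) {k : ℕ}
    (hk : k < n) (c : C) : tally (pairProfile n u v D E) (weight m ρ) (remaining m v k) c =
      ∑ i ∈ Finset.range n, ∑ j ∈ Finset.range n,
        ((if (if k ≤ i then v i else u j) = c then (D i j : ℚ) else 0) +
          if u i = c then (E i j : ℚ) else 0) := by
  rw [pairProfile, tally_sum]
  refine Finset.sum_congr rfl fun i hi => ?_
  rw [tally_sum]
  refine Finset.sum_congr rfl fun j hj => ?_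
  rw [Finset.mem_range] at hi hj
  have hu := h.u_mem_remaining hk.le hj
  have hu' := h.u_mem_remaining hk.le hi
  rw [tally_add, tally_replicate, tally_replicate, weight_ofPair, weight_ofPair,
    Ballot.ofPair_next _ _ _ (h.u_ne_v j hj i hi).symm (.inr hu),
    Ballot.ofPair_next _ _ _ (h.u_ne_v i hi j hj) (.inl hu'), if_neg (h.v_ne i hi),
    if_neg (h.u_ne i hi), if_pos hu']
  simp [h.v_mem_remaining hk.le hi, ← apply_ite some]

theorem Layout.tally_pairProfile_v (h : Layout n m u v) (D E : ℕ → ℕ → ℕ) (ρ : ℚ) {k l : ℕ}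
    (hk : k ≤ l) (hl : l < n) :
    tally (pairProfile n u v D E) (weight m ρ) (remaining m v k) (v l) =
      (∑ j ∈ Finset.range n, D l j : ℕ) := by
  rw [h.tally_pairProfile D E ρ (hk.trans_lt hl), Finset.sum_eq_single_of_mem l (by simpa using hl)]
  · push_cast
    refine Finset.sum_congr rfl fun j _ => ?_
    rw [if_pos hk, if_pos rfl, if_neg (h.u_ne_v l hl l hl), add_zero]
  · intro i hi hil
    refine Finset.sum_eq_zero fun j hj => ?_
    rw [Finset.mem_range] at hi hj
    rw [if_neg (h.u_ne_v i hi l hl), if_neg, add_zero]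
    split_ifs
    · exact fun h' => hil (h.v_inj i hi l hl h')
    · exact h.u_ne_v j hj l hl

theorem Layout.tally_pairProfile_u (h : Layout n m u v) (D E : ℕ → ℕ → ℕ) (ρ : ℚ) {k l : ℕ}
    (hk : k < n) (hl : l < n) :
    tally (pairProfile n u v D E) (weight m ρ) (remaining m v k) (u l) =
      ((∑ j ∈ Finset.range n, E l j) + ∑ i ∈ Finset.range k, D i l : ℕ) := by
  rw [h.tally_pairProfile D E ρ hk]
  simp only [Finset.sum_add_distrib]
  rw [add_comm]
  push_cast
  congr 1
  · rw [Finset.sum_eq_single_of_mem l (by simpa using hl)]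
    · simp
    · intro i hi hil
      refine Finset.sum_eq_zero fun j _ => if_neg fun h' => hil ?_
      exact h.u_inj i (by simpa using hi) l hl h'
  · rw [← Finset.sum_subset (Finset.range_subset_range.2 hk.le)]
    · refine Finset.sum_congr rfl fun i hi => ?_
      rw [Finset.mem_range] at hi
      rw [Finset.sum_eq_single_of_mem l (by simpa using hl)]
      · rw [if_neg (not_le.2 hi), if_pos rfl]
      · intro j hj hjl
        rw [if_neg (not_le.2 hi), if_neg fun h' => hjl (h.u_inj j (by simpa using hj) l hl h')]
    · intro i hi hi'
      rw [Finset.mem_range] at hi hi'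
      refine Finset.sum_eq_zero fun j _ => ?_
      rw [if_pos (not_lt.1 hi'), if_neg (h.u_ne_v l hl i hi).symm]

theorem Layout.tally_univ_pairProfile (h : Layout n m u v) (D E : ℕ → ℕ → ℕ) :
    tally (pairProfile n u v D E) (fun _ => 1) Finset.univ m = 0 := by
  simp only [pairProfile, tally_sum]
  refine Finset.sum_eq_zero fun i hi => Finset.sum_eq_zero fun j hj => ?_
  rw [Finset.mem_range] at hi hj
  rw [tally_add, tally_replicate, tally_replicate,
    Ballot.ofPair_next _ _ _ (h.u_ne_v j hj i hi).symm (.inl (Finset.mem_univ _)),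
    Ballot.ofPair_next _ _ _ (h.u_ne_v i hi j hj) (.inl (Finset.mem_univ _))]
  simp [h.u_ne i hi, h.v_ne i hi]

end Layout
-- Row and column sums of the ballot matrix.
/-- The numbers of ballots from each loser `i` to each winner `j`: nearly all of them go to the
winner with the same index or to the winner `0`, and those of the loser `0` also help every
other winner. -/
def flow (q h g d l e i j : ℕ) : ℕ :=
  (if i = j then if i = 0 then d else if i ≤ q then h - (q + g + 2 * i) else l else 0) +
    (if j = 0 ∧ 0 < i ∧ i ≤ q then 2 * q + 4 * i + g + 3 else 0) +
    if i = 0 ∧ 0 < j then if j ≤ q then 1 else e else 0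

section flow

variable {q h g d l e : ℕ}

theorem sum_flow_zero : ∑ j ∈ Finset.range (q + 2), flow q h g d l e 0 j = d + q + e := by
  have : ∀ j ∈ Finset.range q, flow q h g d l e 0 (j + 1) = 1 := fun j hj => by
    have := Finset.mem_range.1 hj
    simp [flow]
    omega
  rw [Finset.sum_range_succ', Finset.sum_range_succ, Finset.sum_congr rfl this]
  simp [flow]
  ring

/-- The parameter `g` cancels between the two entries of the row. Both lists can thus have the same
first-place totals here while `g` adjusts what the winners finally receive. -/
theorem sum_flow_middle {i : ℕ} (hi : 0 < i) (hiq : i ≤ q) (hh : q + g + 2 * i ≤ h) :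
    ∑ j ∈ Finset.range (q + 2), flow q h g d l e i j = h + q + 2 * i + 3 := by
  simp only [flow, Finset.sum_add_distrib]
  rw [Finset.sum_ite_eq, Finset.sum_eq_single_of_mem 0 (by simp) (by simp_all),
    Finset.sum_eq_zero (by simp; omega)]
  rw [if_pos (Finset.mem_range.2 (by omega)), if_neg hi.ne', if_pos hiq, if_pos ⟨rfl, hi, hiq⟩]
  omega

theorem sum_flow_last : ∑ j ∈ Finset.range (q + 2), flow q h g d l e (q + 1) j = l := by
  simp [flow]

theorem sum_flow_to_zero {k : ℕ} (hk : k ≤ q) :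
    ∑ i ∈ Finset.range (k + 1), flow q h g d l e i 0 =
      d + (2 * (q * k) + 2 * (k * k) + 5 * k + g * k) := by
  induction k with
  | zero => simp [flow]
  | succ k ih =>
    rw [Finset.sum_range_succ, ih (by omega)]
    simp [flow, hk]
    ring

theorem sum_flow_to {j k : ℕ} (hj : 0 < j) :
    ∑ i ∈ Finset.range (k + 1), flow q h g d l e i j =
      (if j ≤ k then if j ≤ q then h - (q + g + 2 * j) else l else 0) +
        if j ≤ q then 1 else e := by
  simp only [flow, Finset.sum_add_distrib]
  rw [Finset.sum_ite_eq', Finset.sum_eq_zero (f := fun i => if j = 0 ∧ 0 < i ∧ i ≤ q then _ else _)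
    fun i _ => if_neg fun h' => hj.ne' h'.1, Finset.sum_eq_single_of_mem 0 (by simp) (by simp_all)]
  simp [hj, hj.ne']

end flow

section Layout

variable {C : Type} [Fintype C] [DecidableEq C] {n : ℕ} {m : C} {u v : ℕ → C}

theorem Layout.eq_of_mem_remaining (h : Layout n m u v) {k : ℕ} (hk : k < n) {c : C}
    (hc : c ∈ remaining m v k) : (∃ j < n, c = u j) ∨ ∃ l < n, k ≤ l ∧ c = v l := by
  rcases h.cover c with rfl | hj | ⟨l, hl, rfl⟩
  · exact absurd rfl ((mem_remaining k _).1 hc).1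
  · exact .inl hj
  · exact .inr ⟨l, hl, (h.v_mem_remaining hk.le hl).1 hc, rfl⟩

/-- The losers' totals `a` do not depend on the round `k`, as in the profiles used here losers never
receive transfers from one another. Integer totals reduce the conditions to arithmetic in `ℕ`. -/
theorem Layout.winnersEq_of_counts (h : Layout n m u v) (hn : 0 < n) {P : Profile C} (M Q : ℕ)
    (hM : (State.initial C).votes P m = M) (hPQ : quota P (n + 1) = Q) (hQ : Q ≤ M) {ρ : ℚ}
    (hρ : ρ = (M - Q) / M) (a : ℕ → ℕ) (b : ℕ → ℕ → ℕ)
    (ha : ∀ k < n, ∀ l < n, k ≤ l → tally P (weight m ρ) (remaining m v k) (v l) = a l)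
    (hb : ∀ k < n, ∀ j < n, tally P (weight m ρ) (remaining m v k) (u j) = b k j)
    (haQ : ∀ l < n, a l < Q) (hbQ : ∀ k < n, ∀ j < n, b k j < Q)
    (haa : ∀ k l, k < l → l < n → a k < a l) (hab : ∀ k < n, ∀ j < n, a k < b k j) :
    WinnersEq P (n + 1) ({m} ∪ (Finset.range n).image u) := by
  subst hPQ
  refine h.winnersEq hn M hM hQ hρ (fun k hk c hc => ?_) fun k hk c hc hck => ?_
  · rcases h.eq_of_mem_remaining hk hc with ⟨j, hj, rfl⟩ | ⟨l, hl, hkl, rfl⟩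
    · rw [hb k hk j hj]
      exact_mod_cast hbQ k hk j hj
    · rw [ha k hk l hl hkl]
      exact_mod_cast haQ l hl
  · rw [ha k hk k hk le_rfl]
    rcases h.eq_of_mem_remaining hk hc with ⟨j, hj, rfl⟩ | ⟨l, hl, hkl, rfl⟩
    · rw [hb k hk j hj]
      exact_mod_cast hab k hk j hj
    · rw [ha k hk l hl hkl]
      have hne : k ≠ l := by
        rintro rfl
        exact hck rfl
      exact_mod_cast haa k l (by omega) hl

end Layout

/-! ### The profile for three or more seats, before and after the addition. -/

/-- The ballots from `z i` to `a j` in the profile for `q + 3` seats. -/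
def flowZA (q h y : ℕ) : ℕ → ℕ → ℕ :=
  flow q h 4 (y - (3 * q + 7)) (2 * h - 1) (2 * q + 7)

/-- The ballots from `a i` to `z j` in the profile for `q + 3` seats. -/
def flowAZ (q h y : ℕ) : ℕ → ℕ → ℕ :=
  flow q h 2 (y - (q + 4)) (2 * h - (2 * q + 7)) 3

/-- A profile for `q + 3` seats in which `m` is elected first, with a small surplus going to
`a 0`. -/
noncomputable def largeProfile {C : Type} [Fintype C] [DecidableEq C] (q h y : ℕ) (m : C)
    (a z : ℕ → C) : Profile C :=
  Multiset.replicate (2 * h + 3) (Ballot.ofPair m (a 0)) +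
    pairProfile (q + 2) a z (flowZA q h y) (flowAZ q h y)

section largeProfile

variable {C : Type} [Fintype C] [DecidableEq C] {q h y : ℕ} {m : C} {a z : ℕ → C}

theorem sum_flowZA (hh : 50 * (q * q) + 300 * q + 450 ≤ h)
    (hy : y + (2 * (q * q) + 4 * q) = h + q + 3) {i : ℕ} (hi : i < q + 2) :
    ∑ j ∈ Finset.range (q + 2), flowZA q h y i j =
      if i = 0 then y else if i ≤ q then h + q + 2 * i + 3 else 2 * h - 1 := by
  unfold flowZA
  split_ifs with h0 h1
  · rw [h0, sum_flow_zero]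
    omega
  · exact sum_flow_middle (Nat.pos_of_ne_zero h0) h1 (by omega)
  · rw [show i = q + 1 by omega, sum_flow_last]

theorem sum_flowAZ (hh : 50 * (q * q) + 300 * q + 450 ≤ h)
    (hy : y + (2 * (q * q) + 4 * q) = h + q + 3) {i : ℕ} (hi : i < q + 2) :
    ∑ j ∈ Finset.range (q + 2), flowAZ q h y i j =
      if i = 0 then y - 1 else if i ≤ q then h + q + 2 * i + 3 else 2 * h - (2 * q + 7) := by
  unfold flowAZ
  split_ifs with h0 h1
  · rw [h0, sum_flow_zero]
    omega
  · exact sum_flow_middle (Nat.pos_of_ne_zero h0) h1 (by omega)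
  · rw [show i = q + 1 by omega, sum_flow_last]

theorem card_largeProfile (hh : 50 * (q * q) + 300 * q + 450 ≤ h)
    (hy : y + (2 * (q * q) + 4 * q) = h + q + 3) :
    (largeProfile q h y m a z).card = (q + 4) * (2 * h) := by
  rw [largeProfile, Multiset.card_add, Multiset.card_replicate, card_pairProfile,
    Finset.sum_congr rfl fun i hi => by
      rw [sum_flowZA hh hy (Finset.mem_range.1 hi), sum_flowAZ hh hy (Finset.mem_range.1 hi)]]
  have hmid : ∀ k ≤ q, ∑ i ∈ Finset.range k,
      ((if i + 1 = 0 then y else if i + 1 ≤ q then h + q + 2 * (i + 1) + 3 else 2 * h - 1) +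
        if i + 1 = 0 then y - 1 else if i + 1 ≤ q then h + q + 2 * (i + 1) + 3
          else 2 * h - (2 * q + 7)) = 2 * (h * k) + 2 * (q * k) + 2 * (k * k) + 8 * k := by
    intro k hk
    induction k with
    | zero => simp
    | succ k ih =>
      rw [Finset.sum_range_succ, ih (by omega)]
      simp [hk]
      ring
  rw [Finset.sum_range_succ', Finset.sum_range_succ, hmid q le_rfl]
  simp only [if_true, Nat.add_eq_zero_iff, one_ne_zero, and_false, if_false,
    show ¬ q + 1 ≤ q by omega]
  have : (q + 4) * (2 * h) = 2 * (h * q) + 8 * h := by ring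
  omega

theorem Layout.tally_univ_largeProfile (hL : Layout (q + 2) m a z) :
    tally (largeProfile q h y m a z) (fun _ => 1) Finset.univ m = (2 * h + 3 : ℕ) := by
  rw [largeProfile, tally_add, hL.tally_univ_pairProfile, tally_replicate,
    Ballot.ofPair_next _ _ _ (hL.u_ne 0 (by omega)).symm (.inl (Finset.mem_univ _))]
  simp

theorem Layout.winnersEq_largeProfile (hL : Layout (q + 2) m a z)
    (hh : 50 * (q * q) + 300 * q + 450 ≤ h)
    (hy : y + (2 * (q * q) + 4 * q) = h + q + 3) :
    WinnersEq (largeProfile q h y m a z) (q + 3) ({m} ∪ (Finset.range (q + 2)).image a) := by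
  have hm : ∀ k < q + 2, ∀ c, tally (Multiset.replicate (2 * h + 3) (Ballot.ofPair m (a 0)))
      (weight m (2 / (2 * h + 3))) (remaining m z k) c = if a 0 = c then 2 else 0 := by
    intro k hk c
    have h0 := hL.u_mem_remaining (k := k) (j := 0) hk.le (by omega)
    rw [tally_replicate, weight_ofPair, if_pos rfl,
      Ballot.ofPair_next _ _ _ (hL.u_ne 0 (by omega)).symm (.inr h0),
      if_neg fun h' => ((mem_remaining k m).1 h').1 rfl]
    simp only [Option.some_inj]
    split_ifs
    · push_cast
      field_simp
    · rfl
  refine hL.winnersEq_of_counts (by omega) (2 * h + 3) (2 * h + 1)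
    (by rw [State.votes_initial, hL.tally_univ_largeProfile]) ?_ (by omega)
    (ρ := 2 / (2 * h + 3)) (by push_cast; ring)
    -- The parameters bring every `a j` to exactly `2 * h` once `z 0`, ..., `z q` are out: below the
    -- quota `2 * h + 1`, yet above the `2 * h - 1` votes of `z (q + 1)`.
    (fun i => if i = 0 then y else if i ≤ q then h + q + 2 * i + 3 else 2 * h - 1)
    (fun k j => (if j = 0 then y - 1 else if j ≤ q then h + q + 2 * j + 3
      else 2 * h - (2 * q + 7)) + (∑ i ∈ Finset.range k, flowZA q h y i j) +
        if j = 0 then 2 else 0) ?_ ?_ ?_ ?_ ?_ ?_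
  · rw [quota, card_largeProfile hh hy, show q + 2 + 1 + 1 = q + 4 by ring,
      Nat.mul_div_cancel_left _ (by omega)]
  · intro k hk l hl hkl
    rw [largeProfile, tally_add, hm k hk, hL.tally_pairProfile_v _ _ _ hkl hl,
      sum_flowZA hh hy hl, if_neg (hL.u_ne_v 0 (by omega) l hl), zero_add]
  · intro k hk j hj
    rw [largeProfile, tally_add, hm k hk, hL.tally_pairProfile_u _ _ _ hk hj,
      sum_flowAZ hh hy hj, add_comm]
    have : a 0 = a j ↔ j = 0 :=
      ⟨fun h' => (hL.u_inj 0 (by omega) j hj h').symm, fun h' => by rw [h']⟩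
    simp only [this]
    push_cast
    rfl
  · intro l hl
    split_ifs <;> omega
  · rintro (_ | k) hk j hj
    · rw [Finset.sum_range_zero]
      split_ifs <;> omega
    · rcases Nat.eq_zero_or_pos j with rfl | hj0
      · rw [flowZA, sum_flow_to_zero (by omega)]
        -- The total of `a 0` is quadratic in `k`; bounding the products by `q * q` leaves a linear
        -- problem.
        have h1 := Nat.mul_le_mul (by omega : k ≤ q) (by omega : k ≤ q)
        have h2 := Nat.mul_le_mul_left q (by omega : k ≤ q)
        simp only [if_true]
        omega
      · rw [flowZA, sum_flow_to hj0]
        split_ifs <;> omega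
  · intro k l hkl hl
    split_ifs <;> omega
  · rintro (_ | k) hk j hj
    · rw [Finset.sum_range_zero]
      split_ifs <;> omega
    · rcases Nat.eq_zero_or_pos j with rfl | hj0
      · rw [flowZA, sum_flow_to_zero (by omega)]
        rcases (by omega : k < q ∨ k = q) with h1 | rfl <;> simp only [if_true] <;>
          split_ifs <;> omega
      · rw [flowZA, sum_flow_to hj0]
        split_ifs <;> omega

theorem Layout.winnersEq_largeProfile_add (hL : Layout (q + 2) m a z)
    (hh : 50 * (q * q) + 300 * q + 450 ≤ h)
    (hy : y + (2 * (q * q) + 4 * q) = h + q + 3) (b : Ballot C)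
    (hb : b.ranking.head? = some (a (q + 1))) :
    WinnersEq (largeProfile q h y m a z + Multiset.replicate (2 * (q + 4)) b) (q + 3)
      ({m} ∪ (Finset.range (q + 2)).image z) := by
  -- The total of `m` equals the new quota, so its ballots are passed on with value 0.
  have hm : ∀ k c, tally (Multiset.replicate (2 * h + 3) (Ballot.ofPair m (a 0)))
      (weight m 0) (remaining m a k) c = 0 := by
    intro k c
    rw [tally_replicate, weight_ofPair, if_pos rfl]
    simp
  -- The candidate `a (q + 1)` is the last to be eliminated, so it holds the added ballots in every
  -- round and only their first slot matters.
  have hbt : ∀ k < q + 2, ∀ c, tally (Multiset.replicate (2 * (q + 4)) b)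
      (weight m 0) (remaining m a k) c = if a (q + 1) = c then (2 * (q + 4) : ℕ) else 0 := by
    intro k hk c
    have h0 := (hL.symm.v_mem_remaining (k := k) (j := q + 1) hk.le (by omega)).2 (by omega)
    rw [tally_replicate, weight, b.next_of_head _ _ hb h0, hb]
    simp [hL.u_ne (q + 1) (by omega)]
  refine hL.symm.winnersEq_of_counts (by omega) (2 * h + 3) (2 * h + 3) ?_ ?_ le_rfl (ρ := 0)
    (by simp)
    -- Here every `z j` ends at `2 * h + 2`, between the `2 * h + 1` votes of `a (q + 1)` and the
    -- quota `2 * h + 3`.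
    (fun i => if i = 0 then y - 1 else if i ≤ q then h + q + 2 * i + 3 else 2 * h + 1)
    (fun k j => (if j = 0 then y else if j ≤ q then h + q + 2 * j + 3
      else 2 * h - 1) + ∑ i ∈ Finset.range k, flowAZ q h y i j) ?_ ?_ ?_ ?_ ?_ ?_
  · rw [State.votes_initial, tally_add, hL.tally_univ_largeProfile, tally_replicate,
      b.next_of_head _ _ hb (Finset.mem_univ _), if_neg, add_zero]
    simpa using hL.u_ne (q + 1) (by omega)
  · rw [quota, Multiset.card_add, card_largeProfile hh hy, Multiset.card_replicate,
      show (q + 4) * (2 * h) + 2 * (q + 4) = (q + 2 + 1 + 1) * (2 * h + 2) by ring,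
      Nat.mul_div_cancel_left _ (by omega)]
  · intro k hk l hl hkl
    rw [largeProfile, pairProfile_comm, tally_add, tally_add, hm k, hbt k hk,
      hL.symm.tally_pairProfile_v _ _ _ hkl hl, sum_flowAZ hh hy hl, zero_add]
    have : a (q + 1) = a l ↔ q + 1 = l :=
      ⟨fun h' => hL.u_inj (q + 1) (by omega) l hl h', fun h' => by rw [h']⟩
    simp only [this]
    norm_cast
    split_ifs <;> omega
  · intro k hk j hj
    rw [largeProfile, pairProfile_comm, tally_add, tally_add, hm k, hbt k hk,
      hL.symm.tally_pairProfile_u _ _ _ hk hj, sum_flowZA hh hy hj,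
      if_neg (hL.u_ne_v (q + 1) (by omega) j hj), zero_add, Nat.cast_zero,
      add_zero]
  · intro l hl
    split_ifs <;> omega
  · rintro (_ | k) hk j hj
    · rw [Finset.sum_range_zero]
      split_ifs <;> omega
    · rcases Nat.eq_zero_or_pos j with rfl | hj0
      · rw [flowAZ, sum_flow_to_zero (by omega)]
        have h1 := Nat.mul_le_mul (by omega : k ≤ q) (by omega : k ≤ q)
        have h2 := Nat.mul_le_mul_left q (by omega : k ≤ q)
        simp only [if_true]
        omega
      · rw [flowAZ, sum_flow_to hj0]
        split_ifs <;> omega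
  · intro k l hkl hl
    split_ifs <;> omega
  · rintro (_ | k) hk j hj
    · rw [Finset.sum_range_zero]
      split_ifs <;> omega
    · rcases Nat.eq_zero_or_pos j with rfl | hj0
      · rw [flowAZ, sum_flow_to_zero (by omega)]
        rcases (by omega : k < q ∨ k = q) with h1 | rfl <;> simp only [if_true] <;>
          split_ifs <;> omega
      · rw [flowAZ, sum_flow_to hj0]
        split_ifs <;> omega

end largeProfile

/-! ### The concrete candidates and the final assembly. -/

theorem mem_take_finRange {N k : ℕ} (c : Fin N) : c ∈ (List.finRange N).take k ↔ (c : ℕ) < k := by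
  simp only [List.mem_take_iff_getElem, List.getElem_finRange, List.length_finRange]
  constructor
  · rintro ⟨i, hi, rfl⟩
    simp
    omega
  · intro h
    exact ⟨c, by omega, by simp⟩

theorem mem_drop_finRange {N k : ℕ} (c : Fin N) : c ∈ (List.finRange N).drop k ↔ k ≤ (c : ℕ) := by
  simp only [List.mem_drop_iff_getElem, List.getElem_finRange, List.length_finRange]
  constructor
  · rintro ⟨i, hi, rfl⟩
    simp
  · intro h
    exact ⟨c - k, by omega, by ext; simp; omega⟩

theorem exists_large_example (q : ℕ) :
    ∃ (P : Profile (Fin (2 * q + 5))) (b : Ballot (Fin (2 * q + 5)))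
      (W W' : Finset (Fin (2 * q + 5))),
      P.card = (q + 4) * 10 ^ (q + 3) ∧ (∀ a ∈ P, a.IsComplete) ∧ b.IsComplete ∧
      WinnersEq P (q + 3) W ∧ WinnersEq (P + Multiset.replicate (2 * (q + 4)) b) (q + 3) W' ∧
      (∀ c ∈ W, c ∈ b.top (q + 3)) ∧ (W ∩ W').card = 1 ∧ (∀ c ∈ b.top (q + 2), c ∉ W') ∧
      (∀ c ∈ b.bottom (q + 2), c ∈ W') := by
  -- This size of `h` keeps the truncated subtractions in the ballot numbers exact and leaves room
  -- for the quadratic terms.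
  have hpow : 100 * (q * q) + 600 * q + 900 ≤ 10 ^ (q + 3) := by
    induction q with
    | zero => norm_num
    | succ q ih =>
      rw [show 10 ^ (q + 1 + 3) = 10 * 10 ^ (q + 3) by ring]
      nlinarith
  obtain ⟨h, hU⟩ : ∃ h, 10 ^ (q + 3) = 2 * h :=
    ⟨5 * 10 ^ (q + 2), by ring⟩
  have hh : 50 * (q * q) + 300 * q + 450 ≤ h := by omega
  obtain ⟨y, hy⟩ : ∃ y, y + (2 * (q * q) + 4 * q) = h + q + 3 :=
    ⟨h + q + 3 - (2 * (q * q) + 4 * q), by omega⟩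
  -- With this numbering the increasing order is the added ballot `a (q + 1) > ⋯ > a 0 > m > z 0 > ⋯
  -- > z (q + 1)`. The `min` in `z` only gives a value to indices that are never used.
  let m : Fin (2 * q + 5) := ⟨q + 2, by omega⟩
  let a : ℕ → Fin (2 * q + 5) := fun i => ⟨q + 1 - i, by omega⟩
  let z : ℕ → Fin (2 * q + 5) := fun i => ⟨min (q + 3 + i) (2 * q + 4), by omega⟩
  have hL : Layout (q + 2) m a z := by
    refine ⟨?_, ?_, ?_, ?_, ?_, ?_⟩
    · intro i hi j hj
      simp only [a, Fin.mk.injEq]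
      omega
    · intro i hi j hj
      simp only [z, Fin.mk.injEq]
      omega
    · intro i hi j hj
      simp only [a, z, ne_eq, Fin.mk.injEq]
      omega
    · intro i hi
      simp only [a, m, ne_eq, Fin.mk.injEq]
      omega
    · intro i hi
      simp only [z, m, ne_eq, Fin.mk.injEq]
      omega
    · rintro ⟨c, hc⟩
      simp only [a, z, m, Fin.mk.injEq]
      rcases lt_trichotomy c (q + 2) with h' | h' | h'
      · exact .inr (.inl ⟨q + 1 - c, by omega, by omega⟩)
      · exact .inl h'
      · exact .inr (.inr ⟨c - (q + 3), by omega, by omega⟩)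
  have hmemW : ∀ c, c ∈ {m} ∪ (Finset.range (q + 2)).image a ↔ (c : ℕ) < q + 3 := by
    intro c
    simp only [Finset.mem_union, Finset.mem_singleton, Finset.mem_image, Finset.mem_range, Fin.ext_iff,
      a, m]
    constructor
    · rintro (h' | ⟨i, hi, h'⟩) <;> omega
    · intro h'
      rcases (by omega : (c : ℕ) = q + 2 ∨ (c : ℕ) < q + 2) with h'' | h''
      · exact .inl h''
      · exact .inr ⟨q + 1 - c, by omega, by omega⟩
  have hmemW' : ∀ c, c ∈ {m} ∪ (Finset.range (q + 2)).image z ↔ q + 2 ≤ (c : ℕ) := by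
    intro c
    have := c.2
    simp only [Finset.mem_union, Finset.mem_singleton, Finset.mem_image, Finset.mem_range, Fin.ext_iff,
      z, m]
    constructor
    · rintro (h' | ⟨i, hi, h'⟩) <;> omega
    · intro h'
      rcases (by omega : (c : ℕ) = q + 2 ∨ q + 2 < (c : ℕ)) with h'' | h''
      · exact .inl h''
      · exact .inr ⟨c - (q + 3), by omega, by omega⟩
  refine ⟨largeProfile q h y m a z, ⟨List.finRange _, List.nodup_finRange _, by simp⟩, _, _, ?_, ?_,
    fun c => List.mem_finRange c, hL.winnersEq_largeProfile hh hy,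
    hL.winnersEq_largeProfile_add hh hy _ ?_, ?_, ?_, ?_, ?_⟩
  · rw [card_largeProfile hh hy, hU]
  · intro c hc
    rcases Multiset.mem_add.1 hc with hc | hc
    · rw [Multiset.eq_of_mem_replicate hc]
      exact Ballot.ofPair_isComplete _ _
    · exact pairProfile_isComplete _ _ c hc
  · simp [List.finRange_succ, a]
  · intro c hc
    exact (mem_take_finRange c).2 ((hmemW c).1 hc)
  · refine Finset.card_eq_one.2 ⟨m, ?_⟩
    ext c
    rw [Finset.mem_inter, hmemW, hmemW', Finset.mem_singleton, Fin.ext_iff]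
    simp only [m]
    omega
  · intro c hc
    rw [hmemW']
    exact not_le.2 ((mem_take_finRange c).1 hc)
  · intro c hc
    rw [hmemW']
    have := (mem_drop_finRange c).1 hc
    simp only [List.length_finRange] at this
    omega

end STV

theorem proposition2 (S : ℕ) (hS : 1 < S) :
    ∃ (n : ℕ) (P : STV.Profile (Fin n)) (b : STV.Ballot (Fin n)) (k : ℕ)
      (W W' : Finset (Fin n)),
      -- the size of the construction
      (S = 2 → n = 4 ∧ P.card = 1000 ∧ k = 3) ∧
      (2 < S → n = 2 * S - 1 ∧ P.card = (S + 1) * 10 ^ S ∧ k = 2 * (S + 1)) ∧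
      -- all ballots rank all candidates
      (∀ a ∈ P, a.IsComplete) ∧ b.IsComplete ∧
      -- the winner sets before and after adding `k` ballots of the form `b`
      STV.WinnersEq P S W ∧ STV.WinnersEq (P + Multiset.replicate k b) S W' ∧
      -- the original winners are ranked in the top `S` slots
      (∀ c ∈ W, c ∈ b.top S) ∧
      -- exactly one of them survives, and the top `S - 1` candidates do not win
      (W ∩ W').card = 1 ∧ (∀ c ∈ b.top (S - 1), c ∉ W') ∧
      -- the bottom `S - 1` candidates win
      (∀ c ∈ b.bottom (S - 1), c ∈ W') := by
  have hq : S = 2 ∨ ∃ q, S = q + 3 := by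
    rcases (by omega : S = 2 ∨ 3 ≤ S) with h | h
    · exact .inl h
    · exact .inr ⟨S - 3, by omega⟩
  rcases hq with rfl | ⟨q, rfl⟩
  · obtain ⟨P, b, W, W', hP, h⟩ := STV.exists_two_seat_example
    exact ⟨4, P, b, 3, W, W', fun _ => ⟨rfl, hP, rfl⟩, fun h2 => absurd h2 (lt_irrefl 2), h⟩
  · obtain ⟨P, b, W, W', hP, h⟩ := STV.exists_large_example q
    exact ⟨2 * q + 5, P, b, 2 * (q + 4), W, W', fun h2 => absurd h2 (by omega),
      fun _ => ⟨by omega, hP, rfl⟩, h⟩
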